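/- Let $S$ be a semigroup and let $S^1$ be the monoid obtained from $S$ by adjoining a new identity. For $a,b\in S$ write $a\le_{\mathcal L}b$ if $a\in S^1b$; $a\le_{\mathcal R}b$ if $a\in bS^1$; $a\le_{\mathcal J}b$ if $a\in S^1bS^1$; and $a\le_{\mathcal H}b$ if $a\le_{\mathcal L}b$ and $a\le_{\mathcal R}b$. For $\mathcal K\in\{\mathcal L,\mathcal R,\mathcal J,\mathcal H\}$, $a\,\mathcal K\,b$ means $a\le_{\mathcal K}b$ and $b\le_{\mathcal K}a$; the $\mathcal K$-classes are partially ordered by $\le_{\mathcal K}$, and the height $H_{\mathcal K}(S)\in\mathbb N\cup\{\infty\}$ is the supremum of the sizes of chains of $\mathcal K$-classes. $H_E(S)$ is the supremum of the sizes of chains in the set of idempotents of $S$ ordered by $f\le e\Leftrightarrow ef=fe=f$. $S$ is left stable if ${\le_{\mathcal L}}\cap\mathcal J=\mathcal L$, right stable if ${\le_{\mathcal R}}\cap\mathcal J=\mathcal R$, and stable if it is both. $S$ is regular if for every $a\in S$ there is $b\in S$ with $a=aba$ and $b=bab$. A semigroup is simple if it has exactly one $\mathcal J$-class, and completely simple if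 moreover it has a minimal $\mathcal L$-class and a minimal $\mathcal R$-class. A semigroup $T$ with zero $0$ is 0-simple if $T^2\ne\{0\}$ and its $\mathcal J$-classes are $\{0\}$ and $T\setminus\{0\}$; it is completely 0-simple if moreover it has a 0-minimal $\mathcal L$-class and a 0-minimal $\mathcal R$-class, where a class is 0-minimal if $\{0\}$ is the only class strictly below it. The principal factor of a $\mathcal J$-class $J$ of $S$ is $J$ itself if $J$ is minimal, and otherwise the Rees quotient of $S^1JS^1$ by its ideal $S^1JS^1\setminus J$, that is, $J\cup\{0\}$ with the product of $a,b\in J$ equal to $ab$ if $ab\in J$ and all other products equal to $0$. $S$ is semisimple if each of its principal factors is simple or 0-simple, and completely semisimple if each of them is completely simple or completely 0-simple. The bicyclic monoid is the monoid with presentation $\langle a,b\mid ab=1\rangle$. Then the following are equivalent: (1) $S$ is regular and stable; (2) $S$ is regular and either left stable or right stable; (3) $S$ is completely semisimple; (4) $S$ is semisimple and stable; (5) $S$ is regular and no subsemigroup of $S$ is isomorphic to the bicyclic monoid. Moreover, if any (hence all) of these conditions hold, then $$H_{\mathcal L}(S)=H_{\mathcal R}(S)=H_{\mathcal H}(S)=H_E(S)=H_{\mathcal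 J}(S).$$ -/

import Mathlib

universe u

/-- The four Green's relations that carry a natural preorder. -/
inductive Green where
  | L
  | R
  | J
  | H

namespace Green

/-- Green's preorders on a semigroup `S`; here `WithOne S` is the monoid `S¹` obtained from `S` by
adjoining a new identity. -/
def le {S : Type u} [Semigroup S] : Green → S → S → Prop
  | L, a, b => ∃ s : WithOne S, (a : WithOne S) = s * b
  | R, a, b => ∃ s : WithOne S, (a : WithOne S) = b * s
  | J, a, b => ∃ s t : WithOne S, (a : WithOne S) = s * b * t
  | H, a, b => ∃ s t : WithOne S, (a : WithOne S) = s * b ∧ (a : WithOne S) = b * t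

/-- Green's relation: mutual comparability under Green's preorder. -/
def rel {S : Type u} [Semigroup S] (k : Green) (a b : S) : Prop :=
  k.le a b ∧ k.le b a

theorem le_refl {S : Type u} [Semigroup S] (k : Green) (a : S) : k.le a a := by
  cases k
  · exact ⟨1, by simp⟩
  · exact ⟨1, by simp⟩
  · exact ⟨1, 1, by simp⟩
  · exact ⟨1, 1, by simp, by simp⟩

theorem le_trans {S : Type u} [Semigroup S] (k : Green) {a b c : S}
    (hab : k.le a b) (hbc : k.le b c) : k.le a c := by
  cases k
  · obtain ⟨s, hs⟩ := hab
    obtain ⟨t, ht⟩ := hbc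
    exact ⟨s * t, by rw [hs, ht, mul_assoc]⟩
  · obtain ⟨s, hs⟩ := hab
    obtain ⟨t, ht⟩ := hbc
    exact ⟨t * s, by rw [hs, ht, mul_assoc]⟩
  · obtain ⟨s, s', hs⟩ := hab
    obtain ⟨t, t', ht⟩ := hbc
    exact ⟨s * t, t' * s', by rw [hs, ht]; simp only [mul_assoc]⟩
  · obtain ⟨s, s', hs, hs'⟩ := hab
    obtain ⟨t, t', ht, ht'⟩ := hbc
    exact ⟨s * t, t' * s', by rw [hs, ht, mul_assoc], by rw [hs', ht', mul_assoc]⟩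

/-- Green's relation as a setoid. -/
def setoid (k : Green) (S : Type u) [Semigroup S] : Setoid S where
  r := k.rel
  iseqv :=
    { refl := fun a => ⟨k.le_refl a, k.le_refl a⟩
      symm := fun h => ⟨h.2, h.1⟩
      trans := fun h h' => ⟨k.le_trans h.1 h'.1, k.le_trans h'.2 h.2⟩ }

/-- The set of `k`-classes of `S`, where `k` is one of Green's relations. -/
def Classes (k : Green) (S : Type u) [Semigroup S] : Type u :=
  Quotient (k.setoid S)

/-- The `k`-class of an element. -/
def classOf {S : Type u} [Semigroup S] (k : Green) (a : S) : k.Classes S :=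
  Quotient.mk (k.setoid S) a

/-- The poset of `k`-classes: the class of `a` is below the class of `b` iff `k.le a b`. -/
instance (k : Green) (S : Type u) [Semigroup S] : PartialOrder (k.Classes S) where
  le c d := Quotient.liftOn₂ c d k.le (fun _ _ _ _ ha hb => propext
    ⟨fun h => k.le_trans ha.2 (k.le_trans h hb.1),
      fun h => k.le_trans ha.1 (k.le_trans h hb.2)⟩)
  le_refl c := Quotient.inductionOn c k.le_refl
  le_trans c d e := Quotient.inductionOn₃ c d e fun _ _ _ h h' => k.le_trans h h'
  le_antisymm c d := Quotient.inductionOn₂ c d fun _ _ h h' => Quotient.sound ⟨h, h'⟩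

theorem classOf_le_classOf {S : Type u} [Semigroup S] (k : Green) {a b : S} :
    k.classOf a ≤ k.classOf b ↔ k.le a b :=
  Iff.rfl

theorem classOf_eq_classOf {S : Type u} [Semigroup S] (k : Green) {a b : S} :
    k.classOf a = k.classOf b ↔ k.rel a b := by
  rw [le_antisymm_iff, classOf_le_classOf, classOf_le_classOf, rel]

theorem exists_classOf_eq {S : Type u} [Semigroup S] (k : Green) (c : k.Classes S) :
    ∃ a : S, k.classOf a = c :=
  Quotient.exists_rep c

/-- The `k`-height of `S`: the supremum in `ℕ∞` of the sizes of chains of `k`-classes. -/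
noncomputable def height (k : Green) (S : Type u) [Semigroup S] : ℕ∞ :=
  (Set.univ : Set (k.Classes S)).chainHeight (· ≤ ·)

end Green

/-- The height `H_E(S)` of the poset of idempotents of `S`, where `f ≤ e` iff `e f = f e = f`. -/
noncomputable def idempotentHeight (S : Type u) [Semigroup S] : ℕ∞ :=
  {e : S | IsIdempotentElem e}.chainHeight (fun f e => e * f = f ∧ f * e = f)

/-- `≤_L ∩ J = L`. -/
def IsLeftStable (S : Type u) [Semigroup S] : Prop :=
  ∀ a b : S, (Green.L.le a b ∧ Green.J.rel a b) ↔ Green.L.rel a b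

/-- `≤_R ∩ J = R`. -/
def IsRightStable (S : Type u) [Semigroup S] : Prop :=
  ∀ a b : S, (Green.R.le a b ∧ Green.J.rel a b) ↔ Green.R.rel a b

def IsStable (S : Type u) [Semigroup S] : Prop :=
  IsLeftStable S ∧ IsRightStable S

def IsRegularSemigroup (S : Type u) [Semigroup S] : Prop :=
  ∀ a : S, ∃ b : S, a = a * b * a ∧ b = b * a * b

/-- `S` has exactly one `J`-class. -/
def IsSimpleSemigroup (S : Type u) [Semigroup S] : Prop :=
  Nonempty S ∧ ∀ a b : S, Green.J.rel a b

/-- A simple semigroup with minimal `L`-classes and minimal `R`-classes. -/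
def IsCompletelySimple (S : Type u) [Semigroup S] : Prop :=
  IsSimpleSemigroup S ∧ (∃ c : Green.L.Classes S, IsMin c) ∧ (∃ c : Green.R.Classes S, IsMin c)

def IsZeroElement {S : Type u} [Semigroup S] (z : S) : Prop :=
  ∀ a : S, z * a = z ∧ a * z = z

/-- `S` is 0-simple with zero element `z`: `S² ≠ {z}`, and the `J`-classes of `S` are exactly `{z}`
and its complement. -/
def IsZeroSimpleWith (S : Type u) [Semigroup S] (z : S) : Prop :=
  IsZeroElement z ∧ (∃ a b : S, a * b ≠ z) ∧ ∀ a b : S, Green.J.rel a b ↔ (a = z ↔ b = z)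

def IsZeroSimple (S : Type u) [Semigroup S] : Prop :=
  ∃ z : S, IsZeroSimpleWith S z

/-- A class is 0-minimal if the class of the zero is the only class strictly below it. -/
def IsZeroMinimal {S : Type u} [Semigroup S] (k : Green) (z : S) (c : k.Classes S) : Prop :=
  ∀ d : k.Classes S, d < c ↔ d = k.classOf z

/-- A 0-simple semigroup with 0-minimal `L`-classes and 0-minimal `R`-classes. -/
def IsCompletelyZeroSimple (S : Type u) [Semigroup S] : Prop :=
  ∃ z : S, IsZeroSimpleWith S z ∧
    (∃ c : Green.L.Classes S, IsZeroMinimal Green.L z c) ∧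
    (∃ c : Green.R.Classes S, IsZeroMinimal Green.R z c)

/-- A (two-sided, nonempty) ideal of a semigroup. -/
structure BiIdeal (S : Type u) [Semigroup S] where
  carrier : Set S
  nonempty : carrier.Nonempty
  mul_mem_left : ∀ (s : S) {a : S}, a ∈ carrier → s * a ∈ carrier
  mul_mem_right : ∀ (s : S) {a : S}, a ∈ carrier → a * s ∈ carrier

/-- The underlying set `(S \ I) ∪ {0}` of the Rees quotient of `S` by `I`. -/
inductive ReesQuotient {S : Type u} [Semigroup S] (I : BiIdeal S) : Type u where
  | zero : ReesQuotient I
  | of (a : S) (ha : a ∉ I.carrier) : ReesQuotient I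

namespace ReesQuotient

variable {S : Type u} [Semigroup S] {I : BiIdeal S}

open Classical in
/-- The image in the Rees quotient of an element of `S`: elements of `I` go to zero. -/
noncomputable def mk (I : BiIdeal S) (a : S) : ReesQuotient I :=
  if ha : a ∈ I.carrier then zero else of a ha

/-- The product is that of `S` if both factors and their product lie outside `I`, and is zero
otherwise. -/
noncomputable instance : Mul (ReesQuotient I) where
  mul
    | of a _, of b _ => mk I (a * b)
    | _, _ => zero

theorem mk_of_mem {a : S} (ha : a ∈ I.carrier) : mk I a = zero := dif_pos ha

theorem mk_of_notMem {a : S} (ha : a ∉ I.carrier) : mk I a = of a ha := dif_neg ha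

theorem zero_mul (x : ReesQuotient I) : zero * x = zero := by
  cases x <;> rfl

theorem mul_zero (x : ReesQuotient I) : x * zero = zero := by
  cases x <;> rfl

theorem mk_mul_mk (a b : S) : mk I a * mk I b = mk I (a * b) := by
  by_cases ha : a ∈ I.carrier
  · rw [mk_of_mem ha, mk_of_mem (I.mul_mem_right b ha), zero_mul]
  · by_cases hb : b ∈ I.carrier
    · rw [mk_of_mem hb, mk_of_mem (I.mul_mem_left a hb), mul_zero]
    · rw [mk_of_notMem ha, mk_of_notMem hb]
      rfl

theorem mk_surjective (x : ReesQuotient I) : ∃ a : S, mk I a = x := by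
  cases x with
  | zero =>
    obtain ⟨a, ha⟩ := I.nonempty
    exact ⟨a, mk_of_mem ha⟩
  | of a ha => exact ⟨a, mk_of_notMem ha⟩

noncomputable instance : Semigroup (ReesQuotient I) where
  mul_assoc x y z := by
    obtain ⟨a, rfl⟩ := mk_surjective x
    obtain ⟨b, rfl⟩ := mk_surjective y
    obtain ⟨c, rfl⟩ := mk_surjective z
    simp only [mk_mul_mk, mul_assoc]

end ReesQuotient

section PrincipalFactor

variable {S : Type u} [Semigroup S]

/-- A `J`-class as a subset of `S`. -/
def jClassSet (c : Green.J.Classes S) : Set S :=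
  {x | Green.J.classOf x = c}

theorem classOf_mul_le_left (x y : S) : Green.J.classOf (x * y) ≤ Green.J.classOf x :=
  (Green.classOf_le_classOf _).2 ⟨1, y, by simp⟩

theorem classOf_mul_le_right (x y : S) : Green.J.classOf (x * y) ≤ Green.J.classOf y :=
  (Green.classOf_le_classOf _).2 ⟨x, 1, by simp⟩

/-- A minimal `J`-class, as a subsemigroup. -/
def minimalIdeal (c : Green.J.Classes S) (hc : IsMin c) : Subsemigroup S where
  carrier := jClassSet c
  mul_mem' := by
    intro x y hx _
    have h : Green.J.classOf (x * y) ≤ c := by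
      have hx' : Green.J.classOf x = c := hx
      rw [← hx']
      exact classOf_mul_le_left x y
    exact hc.eq_of_le h

/-- The subset `S¹ J S¹` of `S`. -/
def principalIdealSet (c : Green.J.Classes S) : Set S :=
  {x | ∃ s t : WithOne S, ∃ j ∈ jClassSet c, (x : WithOne S) = s * j * t}

theorem mem_principalIdealSet_iff {c : Green.J.Classes S} {x : S} :
    x ∈ principalIdealSet c ↔ Green.J.classOf x ≤ c := by
  constructor
  · rintro ⟨s, t, j, hj, h⟩
    have hj' : Green.J.classOf j = c := hj
    rw [← hj']
    exact (Green.classOf_le_classOf _).2 ⟨s, t, h⟩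
  · intro h
    obtain ⟨j, hj⟩ := Green.J.exists_classOf_eq c
    rw [← hj, Green.classOf_le_classOf] at h
    obtain ⟨s, t, h⟩ := h
    exact ⟨s, t, j, hj, h⟩

/-- The subsemigroup `S¹ J S¹` of `S`. -/
def principalIdeal (c : Green.J.Classes S) : Subsemigroup S where
  carrier := principalIdealSet c
  mul_mem' := by
    intro x y hx _
    exact mem_principalIdealSet_iff.2
      ((classOf_mul_le_left x y).trans (mem_principalIdealSet_iff.1 hx))

/-- For a non-minimal `J`-class, the ideal `S¹ J S¹ \ J` of the semigroup `S¹ J S¹`. -/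
def belowIdeal (c : Green.J.Classes S) (hc : ¬ IsMin c) : BiIdeal (principalIdeal c) where
  carrier := {x | (x : S) ∉ jClassSet c}
  nonempty := by
    obtain ⟨d, hd⟩ := not_isMin_iff.1 hc
    obtain ⟨x, hx⟩ := Green.J.exists_classOf_eq d
    rw [← hx] at hd
    exact ⟨⟨x, mem_principalIdealSet_iff.2 hd.le⟩, fun h => hd.ne h⟩
  mul_mem_left := by
    intro s a ha h
    have ha1 : Green.J.classOf (a : S) ≤ c := mem_principalIdealSet_iff.1 a.2
    have h1 : Green.J.classOf ((s : S) * (a : S)) = c := h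
    exact ha (le_antisymm ha1 (h1.symm.le.trans (classOf_mul_le_right _ _)))
  mul_mem_right := by
    intro s a ha h
    have ha1 : Green.J.classOf (a : S) ≤ c := mem_principalIdealSet_iff.1 a.2
    have h1 : Green.J.classOf ((a : S) * (s : S)) = c := h
    exact ha (le_antisymm ha1 (h1.symm.le.trans (classOf_mul_le_left _ _)))

open Classical in
/-- The principal factor of a `J`-class `J`: the class itself if it is minimal, and otherwise the
Rees quotient of `S¹ J S¹` by `S¹ J S¹ \ J`. -/
noncomputable def principalFactor (c : Green.J.Classes S) : Semigrp.{u} :=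
  if hc : IsMin c then Semigrp.of (minimalIdeal c hc)
  else Semigrp.of (ReesQuotient (belowIdeal c hc))

end PrincipalFactor

/-- Every principal factor is simple or 0-simple. -/
def IsSemisimpleSemigroup (S : Type u) [Semigroup S] : Prop :=
  ∀ c : Green.J.Classes S,
    IsSimpleSemigroup (principalFactor c) ∨ IsZeroSimple (principalFactor c)

/-- Every principal factor is completely simple or completely 0-simple. -/
def IsCompletelySemisimple (S : Type u) [Semigroup S] : Prop :=
  ∀ c : Green.J.Classes S,
    IsCompletelySimple (principalFactor c) ∨ IsCompletelyZeroSimple (principalFactor c)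

/-- The single defining relation `a b = 1` of the bicyclic monoid, where `a` is the generator
indexed by `true` and `b` the one indexed by `false`. -/
inductive BicyclicRel : FreeMonoid Bool → FreeMonoid Bool → Prop where
  | ab_eq_one : BicyclicRel (FreeMonoid.of true * FreeMonoid.of false) 1

/-- The bicyclic monoid `⟨a, b | a b = 1⟩`. -/
abbrev BicyclicMonoid : Type := PresentedMonoid BicyclicRel

/-- `S` has a subsemigroup isomorphic to the bicyclic monoid. -/
def ContainsBicyclic (S : Type u) [Semigroup S] : Prop :=
  ∃ f : BicyclicMonoid →ₙ* S, Function.Injective f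

/-! Stability makes two comparable idempotents in one `J`-class equal. Conversely, if `S` is
regular and idempotents `e < f` are `J`-related, say `f = s e t`, then `x = s e` and `y = e t`
satisfy `x y = f` and `y x ≠ f`, so they generate a bicyclic monoid; hence a regular semigroup that
is not left (or right) stable contains a bicyclic monoid, and the identity `1` and the idempotent
`b a` of a bicyclic monoid violate both stabilities.

A principal factor is simple or 0-simple exactly when its `J`-class contains one of its own
products, and then every element `a` of the class is `x m y` with `x`, `m`, `y` in the class and
`m` prescribed. Taking `m` in a minimal or 0-minimal `L`-class, that minimality propagates along
`x m y` to all of the `J`-class, which is left stability. In a stable semigroup an element `a = b d`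
with factors in its own `J`-class satisfies `a R b` and `a L d`, which makes it regular.

For the heights, stability gives `H_H ≤ H_L, H_R ≤ H_J`, idempotents embed into `H`-classes, and in
a regular semigroup a chain of `J`-classes lifts, from the top down, to a chain of idempotents. -/

namespace Green

variable {S : Type u} [Semigroup S] {a b c : S} {k : Green}

theorem exists_coe_eq_coe_mul (a : S) (s : WithOne S) : ∃ b : S, (b : WithOne S) = a * s := by
  cases s with
  | one => exact ⟨a, (mul_one _).symm⟩
  | coe s => exact ⟨a * s, WithOne.coe_mul a s⟩

theorem exists_coe_eq_mul_coe (s : WithOne S) (a : S) : ∃ b : S, (b : WithOne S) = s * a := by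
  cases s with
  | one => exact ⟨a, (one_mul _).symm⟩
  | coe s => exact ⟨s * a, WithOne.coe_mul s a⟩

theorem L_le_iff : Green.L.le a b ↔ a = b ∨ ∃ s, a = s * b := by
  simp only [le, WithOne.exists, one_mul, ← WithOne.coe_mul, WithOne.coe_inj]

theorem R_le_iff : Green.R.le a b ↔ a = b ∨ ∃ s, a = b * s := by
  simp only [le, WithOne.exists, mul_one, ← WithOne.coe_mul, WithOne.coe_inj]

theorem H_le_iff : Green.H.le a b ↔ Green.L.le a b ∧ Green.R.le a b :=
  exists_and_exists_comm.symm

theorem L_mul_le_right (a b : S) : Green.L.le (a * b) b := L_le_iff.2 (.inr ⟨a, rfl⟩)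

theorem R_mul_le_left (a b : S) : Green.R.le (a * b) a := R_le_iff.2 (.inr ⟨b, rfl⟩)

theorem L_le_mul_right (h : Green.L.le a b) (c : S) : Green.L.le (a * c) (b * c) := by
  obtain ⟨s, h⟩ := h
  exact ⟨s, by rw [WithOne.coe_mul, WithOne.coe_mul, h, mul_assoc]⟩

theorem J_le_of_le (h : k.le a b) : Green.J.le a b := by
  cases k with
  | L => obtain ⟨s, h⟩ := h; exact ⟨s, 1, by rwa [mul_one]⟩
  | R => obtain ⟨t, h⟩ := h; exact ⟨1, t, by rwa [one_mul]⟩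
  | J => exact h
  | H => obtain ⟨s, -, h, -⟩ := h; exact ⟨s, 1, by rwa [mul_one]⟩

theorem J_rel_of_rel (h : k.rel a b) : Green.J.rel a b := ⟨J_le_of_le h.1, J_le_of_le h.2⟩

theorem J_mul_le_left (a b : S) : Green.J.le (a * b) a := J_le_of_le (R_mul_le_left a b)

theorem J_mul_le_right (a b : S) : Green.J.le (a * b) b := J_le_of_le (L_mul_le_right a b)

theorem J_mul_mul_le (a b c : S) : Green.J.le (a * b * c) b :=
  Green.J.le_trans (J_mul_le_left _ _) (J_mul_le_right _ _)

theorem exists_mul_mul_eq_of_J_le (h : Green.J.le a b) (x y : S) :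
    ∃ x' y', Green.R.le x' x ∧ Green.L.le y' y ∧ x * a * y = x' * b * y' := by
  obtain ⟨s, t, h⟩ := h
  obtain ⟨x', hx⟩ := exists_coe_eq_coe_mul x s
  obtain ⟨y', hy⟩ := exists_coe_eq_mul_coe t y
  refine ⟨x', y', ⟨s, hx⟩, ⟨t, hy⟩, WithOne.coe_injective ?_⟩
  simp only [WithOne.coe_mul, h, hx, hy, mul_assoc]

theorem exists_eq_mul_of_J_le_mul (h : Green.J.le a (b * c)) :
    ∃ b' c', Green.L.le b' b ∧ Green.R.le c' c ∧ a = b' * c' := by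
  obtain ⟨s, t, h⟩ := h
  obtain ⟨b', hb⟩ := exists_coe_eq_mul_coe s b
  obtain ⟨c', hc⟩ := exists_coe_eq_coe_mul c t
  refine ⟨b', c', ⟨s, hb⟩, ⟨t, hc⟩, WithOne.coe_injective ?_⟩
  simp only [WithOne.coe_mul, h, hb, hc, mul_assoc]

theorem J_le_iff_exists : Green.J.le a b ↔ ∃ m, Green.L.le m b ∧ Green.R.le a m := by
  refine ⟨fun ⟨s, t, h⟩ => ?_, fun ⟨m, hm, ha⟩ =>
    Green.J.le_trans (J_le_of_le ha) (J_le_of_le hm)⟩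
  obtain ⟨m, hm⟩ := exists_coe_eq_mul_coe s b
  exact ⟨m, ⟨s, hm⟩, ⟨t, by rw [hm, h]⟩⟩

theorem J_le_iff_exists' : Green.J.le a b ↔ ∃ m, Green.R.le m b ∧ Green.L.le a m := by
  refine ⟨fun ⟨s, t, h⟩ => ?_, fun ⟨m, hm, ha⟩ =>
    Green.J.le_trans (J_le_of_le ha) (J_le_of_le hm)⟩
  obtain ⟨m, hm⟩ := exists_coe_eq_coe_mul b t
  exact ⟨m, ⟨t, hm⟩, ⟨s, by rw [hm, h, mul_assoc]⟩⟩

section Idempotent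

variable {e f : S}

theorem mul_eq_of_L_le (he : IsIdempotentElem e) (h : Green.L.le a e) : a * e = a := by
  obtain ⟨s, h⟩ := h
  apply WithOne.coe_injective
  rw [WithOne.coe_mul, h, mul_assoc, ← WithOne.coe_mul, he.eq]

theorem mul_eq_of_R_le (he : IsIdempotentElem e) (h : Green.R.le a e) : e * a = a := by
  obtain ⟨s, h⟩ := h
  apply WithOne.coe_injective
  rw [WithOne.coe_mul, h, ← mul_assoc, ← WithOne.coe_mul, he.eq]

theorem eq_of_H_rel (he : IsIdempotentElem e) (hf : IsIdempotentElem f)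
    (h : Green.H.rel e f) : e = f :=
  (mul_eq_of_L_le hf (H_le_iff.1 h.1).1).symm.trans (mul_eq_of_R_le he (H_le_iff.1 h.2).2)

theorem exists_mul_mul_eq_of_idempotent_J_le (he : IsIdempotentElem e) (h : Green.J.le e a) :
    ∃ x y, e * x = x ∧ y * e = y ∧ x * a * y = e := by
  obtain ⟨x, y, hx, hy, hxy⟩ := exists_mul_mul_eq_of_J_le h e e
  exact ⟨x, y, mul_eq_of_R_le he hx, mul_eq_of_L_le he hy, by rw [← hxy, he.eq, he.eq]⟩

end Idempotent

section Opposite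

open MulOpposite

theorem L_le_op_iff : Green.L.le (op a) (op b) ↔ Green.R.le a b := by
  simp only [L_le_iff, R_le_iff, MulOpposite.exists, ← op_mul, op_inj]

theorem R_le_op_iff : Green.R.le (op a) (op b) ↔ Green.L.le a b := by
  simp only [L_le_iff, R_le_iff, MulOpposite.exists, ← op_mul, op_inj]

theorem J_le_op_iff : Green.J.le (op a) (op b) ↔ Green.J.le a b := by
  rw [J_le_iff_exists, J_le_iff_exists']
  simp only [MulOpposite.exists, L_le_op_iff, R_le_op_iff]

theorem J_rel_op_iff : Green.J.rel (op a) (op b) ↔ Green.J.rel a b :=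
  and_congr J_le_op_iff J_le_op_iff

end Opposite

end Green

section Stability

variable {S : Type u} [Semigroup S]

theorem isLeftStable_iff :
    IsLeftStable S ↔ ∀ a b : S, Green.L.le a b → Green.J.rel a b → Green.L.le b a :=
  ⟨fun h a b hl hj => ((h a b).1 ⟨hl, hj⟩).2, fun h a b =>
    ⟨fun hab => ⟨hab.1, h a b hab.1 hab.2⟩, fun hab => ⟨hab.1, Green.J_rel_of_rel hab⟩⟩⟩

theorem isRightStable_iff :
    IsRightStable S ↔ ∀ a b : S, Green.R.le a b → Green.J.rel a b → Green.R.le b a :=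
  ⟨fun h a b hl hj => ((h a b).1 ⟨hl, hj⟩).2, fun h a b =>
    ⟨fun hab => ⟨hab.1, h a b hab.1 hab.2⟩, fun hab => ⟨hab.1, Green.J_rel_of_rel hab⟩⟩⟩

theorem isLeftStable_op_iff : IsLeftStable Sᵐᵒᵖ ↔ IsRightStable S := by
  simp only [isLeftStable_iff, isRightStable_iff, MulOpposite.forall, Green.L_le_op_iff,
    Green.J_rel_op_iff]

end Stability

namespace IsRegularSemigroup

variable {S : Type u} [Semigroup S]

theorem of_forall_exists_eq_mul_mul (h : ∀ a : S, ∃ w, a = a * w * a) : IsRegularSemigroup S := by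
  intro a
  obtain ⟨w, hw⟩ := h a
  refine ⟨w * a * w, ?_, ?_⟩
  · calc a = a * w * a * w * a := by rw [← hw, ← hw]
      _ = a * (w * a * w) * a := by simp only [mul_assoc]
  · calc w * a * w = w * (a * w * a * w * a) * w := by rw [← hw, ← hw]
      _ = w * a * w * a * (w * a * w) := by simp only [mul_assoc]

theorem op (h : IsRegularSemigroup S) : IsRegularSemigroup Sᵐᵒᵖ := by
  refine of_forall_exists_eq_mul_mul fun a => ?_
  obtain ⟨b, hab, -⟩ := h a.unop
  exact ⟨MulOpposite.op b, MulOpposite.unop_injective (by simpa [mul_assoc] using hab)⟩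

theorem exists_idempotent_L_rel (h : IsRegularSemigroup S) (a : S) :
    ∃ e, IsIdempotentElem e ∧ Green.L.rel a e := by
  obtain ⟨b, hab, hba⟩ := h a
  refine ⟨b * a, by rw [IsIdempotentElem, ← mul_assoc, ← hba], ?_, Green.L_mul_le_right b a⟩
  exact Green.L_le_iff.2 (.inr ⟨a, by rwa [← mul_assoc]⟩)

theorem exists_idempotent_le (h : IsRegularSemigroup S) {a e : S} (he : IsIdempotentElem e)
    (hae : Green.J.le a e) :
    ∃ f, IsIdempotentElem f ∧ (e * f = f ∧ f * e = f) ∧ Green.J.rel f a := by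
  obtain ⟨g, hg, hagL⟩ := h.exists_idempotent_L_rel a
  have hag := Green.J_rel_of_rel hagL
  obtain ⟨x, y, hgx, -, hxy⟩ :=
    Green.exists_mul_mul_eq_of_idempotent_J_le hg (Green.J.le_trans hag.2 hae)
  obtain ⟨u, hu⟩ : ∃ u, u = e * y := ⟨_, rfl⟩
  obtain ⟨v, hv⟩ : ∃ v, v = x * e := ⟨_, rfl⟩
  have hvu : v * u = g := by rw [hu, hv, mul_assoc, ← mul_assoc e, he.eq, ← mul_assoc, hxy]
  have hgv : g * v = v := by rw [hv, ← mul_assoc, hgx]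
  have huv : u * v = u * g * v := by rw [mul_assoc, hgv]
  have hg' : g = v * (u * v) * u := by
    rw [← mul_assoc, hvu, mul_assoc, hvu, hg.eq]
  refine ⟨u * v, ?_, ⟨?_, ?_⟩, Green.J.le_trans ?_ hag.2, Green.J.le_trans hag.1 ?_⟩
  · rw [IsIdempotentElem, mul_assoc, ← mul_assoc v, hvu, hgv]
  · rw [hu, ← mul_assoc, ← mul_assoc, he.eq]
  · rw [hv, mul_assoc, mul_assoc, he.eq]
  · exact huv ▸ Green.J_mul_mul_le u g v
  · conv_lhs => rw [hg']
    exact Green.J_mul_mul_le v (u * v) u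

end IsRegularSemigroup

section Heights

theorem chainHeight_le_chainHeight_of_mapsTo {α β : Type*} {r : α → α → Prop} {r' : β → β → Prop}
    {s : Set α} {t : Set β} (f : α → β) (hf : Set.MapsTo f s t)
    (hr : ∀ x ∈ s, ∀ y ∈ s, r x y → r' (f x) (f y))
    (hi : ∀ x ∈ s, ∀ y ∈ s, r x y → f x = f y → x = y) :
    s.chainHeight r ≤ t.chainHeight r' := by
  refine iSup_le fun ⟨w, hw, hc⟩ => ?_
  have hinj : Set.InjOn f w := fun x hx y hy hxy => by
    by_contra hne
    obtain h | h := hc hx hy hne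
    · exact hne (hi x (hw hx) y (hw hy) h hxy)
    · exact hne (hi y (hw hy) x (hw hx) h hxy.symm).symm
  change w.encard ≤ _
  rw [← hinj.encard_image]
  refine Set.encard_le_chainHeight_of_isChain _ _ (hf.mono_left hw).image_subset ?_
  rintro _ ⟨x, hx, rfl⟩ _ ⟨y, hy, rfl⟩ hne
  exact (hc hx hy fun h => hne (h ▸ rfl)).imp (hr x (hw hx) y (hw hy)) (hr y (hw hy) x (hw hx))

section Lifting

variable {α β : Type*} [PartialOrder β] {r : α → α → Prop} [IsTrans α r] {s : Set α} {t : Set β}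
  {f : α → β}

theorem exists_isChain_subset_image_of_lift
    (hlift : ∀ a ∈ s, ∀ b ∈ t, b ≤ f a → ∃ a' ∈ s, r a' a ∧ f a' = b) (c : Finset β)
    (hct : ↑c ⊆ t) (hc : IsChain (· ≤ ·) (c : Set β)) {a : α} (ha : a ∈ s)
    (hca : ∀ b ∈ c, b ≤ f a) :
    ∃ w ⊆ s, (∀ x ∈ w, r x a) ∧ IsChain r w ∧ (c : Set β) ⊆ f '' w := by
  classical
  induction c using Finset.strongInduction generalizing a with
  | H c ih =>
    obtain rfl | hne := c.eq_empty_or_nonempty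
    · exact ⟨∅, by simp⟩
    obtain ⟨b, hb⟩ := c.exists_maximal hne
    obtain ⟨a', ha', ha'a, rfl⟩ := hlift a ha b (hct hb.prop) (hca b hb.prop)
    have hca' : ∀ d ∈ c.erase (f a'), d ≤ f a' := fun d hd =>
      (hc.total (Finset.mem_of_mem_erase hd) hb.prop).elim id
        (hb.le_of_ge (Finset.mem_of_mem_erase hd))
    have hsub : (c.erase (f a') : Set β) ⊆ c := Finset.coe_subset.2 (c.erase_subset _)
    obtain ⟨w, hws, hwa', hw, hcw⟩ := ih (c.erase (f a')) (Finset.erase_ssubset hb.prop)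
      (hsub.trans hct) (hc.mono hsub) ha' hca'
    refine ⟨insert a' w, Set.insert_subset ha' hws, ?_,
      hw.insert fun x hx _ => .inr (hwa' x hx), ?_⟩
    · rintro x (rfl | hx)
      exacts [ha'a, _root_.trans (hwa' x hx) ha'a]
    · rw [Set.image_insert_eq, ← Finset.insert_erase hb.prop, Finset.coe_insert]
      exact Set.insert_subset_insert hcw

theorem chainHeight_le_chainHeight_of_lift (hsurj : Set.SurjOn f s t)
    (hlift : ∀ a ∈ s, ∀ b ∈ t, b ≤ f a → ∃ a' ∈ s, r a' a ∧ f a' = b) :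
    t.chainHeight (· ≤ ·) ≤ s.chainHeight r := by
  refine ENat.forall_natCast_le_iff_le.mp fun n hn => ?_
  obtain ⟨c, hct, hcn, hc⟩ := Set.exists_isChain_of_le_chainHeight n hn
  lift c to Finset β using Set.finite_of_encard_eq_coe hcn
  obtain rfl | hne := c.eq_empty_or_nonempty
  · simp [← hcn]
  obtain ⟨b, hb⟩ := c.exists_maximal hne
  obtain ⟨a, ha, rfl⟩ := hsurj (hct hb.prop)
  obtain ⟨w, hws, -, hw, hcw⟩ := exists_isChain_subset_image_of_lift hlift c hct hc ha
    fun d hd => (hc.total hd hb.prop).elim id (hb.le_of_ge hd)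
  calc (n : ℕ∞) = (c : Set β).encard := hcn.symm
    _ ≤ (f '' w).encard := Set.encard_le_encard hcw
    _ ≤ w.encard := Set.encard_image_le f w
    _ ≤ s.chainHeight r := Set.encard_le_chainHeight_of_isChain _ _ hws hw

end Lifting

variable {S : Type u} [Semigroup S]

theorem Green.height_le_height {k l : Green} (h : ∀ a b : S, k.le a b → l.le a b)
    (h' : ∀ a b : S, k.le a b → l.rel a b → k.le b a) : k.height S ≤ l.height S := by
  refine chainHeight_le_chainHeight_of_mapsTo
    (Quotient.map' id fun a b hab => ⟨h a b hab.1, h b a hab.2⟩) (Set.mapsTo_univ _ _) ?_ ?_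
  · intro x _ y _
    induction x, y using Quotient.inductionOn₂ with
    | _ a b => exact h a b
  · intro x _ y _
    induction x, y using Quotient.inductionOn₂ with
    | _ a b => exact fun hab he =>
        (Green.classOf_eq_classOf k).2 ⟨hab, h' a b hab ((Green.classOf_eq_classOf l).1 he)⟩

theorem idempotentHeight_le_height_H : idempotentHeight S ≤ Green.H.height S := by
  refine chainHeight_le_chainHeight_of_mapsTo Green.H.classOf (Set.mapsTo_univ _ _) ?_ ?_
  · rintro f - e - ⟨h, h'⟩
    exact (Green.classOf_le_classOf _).2
      (Green.H_le_iff.2 ⟨h' ▸ Green.L_mul_le_right f e, h ▸ Green.R_mul_le_left e f⟩)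
  · exact fun f hf e he _ h => Green.eq_of_H_rel hf he ((Green.classOf_eq_classOf _).1 h)

theorem IsRegularSemigroup.height_J_le_idempotentHeight (h : IsRegularSemigroup S) :
    Green.J.height S ≤ idempotentHeight S := by
  have : IsTrans S fun f e => e * f = f ∧ f * e = f := ⟨fun g f e ⟨hfg, hgf⟩ ⟨hef, hfe⟩ =>
    ⟨by rw [← hfg, ← mul_assoc, hef], by rw [← hgf, mul_assoc, hfe]⟩⟩
  refine chainHeight_le_chainHeight_of_lift (f := Green.J.classOf) (fun c _ => ?_) ?_
  · obtain ⟨a, rfl⟩ := Green.J.exists_classOf_eq c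
    obtain ⟨e, he, hae⟩ := h.exists_idempotent_L_rel a
    exact ⟨e, he, ((Green.classOf_eq_classOf _).2 (Green.J_rel_of_rel hae)).symm⟩
  · intro e he c _ hce
    obtain ⟨a, rfl⟩ := Green.J.exists_classOf_eq c
    obtain ⟨f, hf, hfe, hfa⟩ := h.exists_idempotent_le he ((Green.classOf_le_classOf _).1 hce)
    exact ⟨f, hf, hfe, (Green.classOf_eq_classOf _).2 hfa⟩

theorem IsLeftStable.height_L_le_height_J (h : IsLeftStable S) :
    Green.L.height S ≤ Green.J.height S :=
  Green.height_le_height (fun _ _ => Green.J_le_of_le) (isLeftStable_iff.1 h)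

theorem IsRightStable.height_R_le_height_J (h : IsRightStable S) :
    Green.R.height S ≤ Green.J.height S :=
  Green.height_le_height (fun _ _ => Green.J_le_of_le) (isRightStable_iff.1 h)

theorem IsRightStable.height_H_le_height_L (h : IsRightStable S) :
    Green.H.height S ≤ Green.L.height S :=
  Green.height_le_height (fun _ _ hab => (Green.H_le_iff.1 hab).1) fun a b hab hL =>
    Green.H_le_iff.2
      ⟨hL.2, isRightStable_iff.1 h a b (Green.H_le_iff.1 hab).2 (Green.J_rel_of_rel hL)⟩

theorem IsLeftStable.height_H_le_height_R (h : IsLeftStable S) :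
    Green.H.height S ≤ Green.R.height S :=
  Green.height_le_height (fun _ _ hab => (Green.H_le_iff.1 hab).2) fun a b hab hR =>
    Green.H_le_iff.2
      ⟨isLeftStable_iff.1 h a b (Green.H_le_iff.1 hab).1 (Green.J_rel_of_rel hR), hR.2⟩

theorem IsRegularSemigroup.heights_eq (h : IsRegularSemigroup S) (hs : IsStable S) :
    Green.L.height S = Green.R.height S ∧ Green.R.height S = Green.H.height S ∧
      Green.H.height S = idempotentHeight S ∧ idempotentHeight S = Green.J.height S := by
  have hJE := h.height_J_le_idempotentHeight
  have hEH := idempotentHeight_le_height_H (S := S)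
  have hHL := hs.2.height_H_le_height_L
  have hHR := hs.1.height_H_le_height_R
  have hLJ := hs.1.height_L_le_height_J
  have hRJ := hs.2.height_R_le_height_J
  have hJH := hJE.trans hEH
  have hLH := hHL.antisymm' (hLJ.trans hJH)
  have hRH := hHR.antisymm' (hRJ.trans hJH)
  have hHE := hEH.antisymm' ((hHL.trans hLJ).trans hJE)
  exact ⟨hLH.trans hRH.symm, hRH, hHE, hJE.antisymm' (hEH.trans (hHL.trans hLJ))⟩

end Heights

section Bicyclic

namespace BicyclicMonoid

/-- The generator `a` of the bicyclic monoid `⟨a, b | a b = 1⟩`. -/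
def genA : BicyclicMonoid := PresentedMonoid.of BicyclicRel true

/-- The generator `b` of the bicyclic monoid `⟨a, b | a b = 1⟩`. -/
def genB : BicyclicMonoid := PresentedMonoid.of BicyclicRel false

theorem genA_mul_genB : genA * genB = 1 :=
  PresentedMonoid.mk_eq_mk_of_rel BicyclicRel.ab_eq_one

theorem exists_eq_pow_mul_pow (q : BicyclicMonoid) : ∃ m n : ℕ, q = genB ^ m * genA ^ n := by
  induction q using PresentedMonoid.inductionOn with
  | _ w =>
    induction w using FreeMonoid.inductionOn' with
    | one => exact ⟨0, 0, rfl⟩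
    | of_mul i w ih =>
      obtain ⟨m, n, h⟩ := ih
      rw [map_mul, h]
      match i, m with
      | false, m => exact ⟨m + 1, n, by rw [pow_succ', mul_assoc]; rfl⟩
      | true, 0 => exact ⟨0, n + 1, by rw [pow_zero, one_mul, one_mul, pow_succ']; rfl⟩
      | true, m + 1 =>
        refine ⟨m, n, ?_⟩
        change genA * (genB ^ (m + 1) * genA ^ n) = _
        rw [pow_succ', mul_assoc, ← mul_assoc genA, genA_mul_genB, one_mul]

section Lift

variable {M : Type*} [Monoid M] {x y : M}

/-- The homomorphism `a ↦ x`, `b ↦ y` out of the bicyclic monoid, for `x y = 1`. -/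
def lift (h : x * y = 1) : BicyclicMonoid →* M :=
  PresentedMonoid.lift (fun i : Bool => if i then x else y) (by
    rintro _ _ ⟨⟩
    simpa using h)

theorem lift_genA (h : x * y = 1) : lift h genA = x := rfl

theorem lift_genB (h : x * y = 1) : lift h genB = y := rfl

theorem eq_zero_of_pow_mul_pow_eq_one (h : x * y = 1) (h' : y * x ≠ 1) {i j : ℕ}
    (hij : y ^ i * x ^ j = 1) : i = 0 ∧ j = 0 := by
  match i, j with
  | 0, 0 => exact ⟨rfl, rfl⟩
  | i + 1, 0 =>
    rw [pow_zero, mul_one, pow_succ'] at hij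
    exact absurd (left_inv_eq_right_inv h hij ▸ hij) h'
  | i, j + 1 =>
    rw [pow_succ, ← mul_assoc] at hij
    exact absurd (left_inv_eq_right_inv hij h ▸ hij) h'

theorem eq_of_pow_mul_pow_eq (h : x * y = 1) (h' : y * x ≠ 1) {m n k l : ℕ} (hmk : m ≤ k)
    (he : y ^ m * x ^ n = y ^ k * x ^ l) : m = k ∧ n = l := by
  have hpow (i : ℕ) : x ^ i * y ^ i = 1 := pow_mul_pow_eq_one i h
  obtain ⟨d, rfl⟩ := Nat.exists_eq_add_of_le hmk
  have hxn : x ^ n = y ^ d * x ^ l := by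
    have := congrArg (x ^ m * ·) he
    simpa only [pow_add, ← mul_assoc, hpow, one_mul] using this
  obtain hnl | hnl := le_total n l
  · obtain ⟨p, rfl⟩ := Nat.exists_eq_add_of_le' hnl
    have hdp : 1 = y ^ d * x ^ p := by
      have := congrArg (· * y ^ n) hxn
      simpa only [pow_add, mul_assoc, hpow, mul_one] using this
    have := eq_zero_of_pow_mul_pow_eq_one h h' hdp.symm
    omega
  · obtain ⟨p, rfl⟩ := Nat.exists_eq_add_of_le' hnl
    have hpd : 1 = y ^ (d + p) * x ^ 0 := by
      have := congrArg (· * y ^ l * y ^ p) hxn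
      simpa only [pow_add, pow_zero, mul_assoc, hpow, mul_one] using this
    have := eq_zero_of_pow_mul_pow_eq_one h h' hpd.symm
    omega

theorem lift_injective (h : x * y = 1) (h' : y * x ≠ 1) : Function.Injective (lift h) := by
  intro q r hqr
  obtain ⟨m, n, rfl⟩ := exists_eq_pow_mul_pow q
  obtain ⟨k, l, rfl⟩ := exists_eq_pow_mul_pow r
  simp only [map_mul, map_pow, lift_genA, lift_genB] at hqr
  have : m = k ∧ n = l := by
    obtain hmk | hmk := le_total m k
    · exact eq_of_pow_mul_pow_eq h h' hmk hqr
    · exact (eq_of_pow_mul_pow_eq h h' hmk hqr.symm).imp Eq.symm Eq.symm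
  rw [this.1, this.2]

end Lift

theorem genB_mul_genA_ne_one : genB * genA ≠ 1 := by
  let pred : Function.End ℕ := Nat.pred
  let succ : Function.End ℕ := Nat.succ
  have h : pred * succ = 1 := rfl
  intro h'
  have hsp := congrArg (lift h) h'
  rw [map_mul, lift_genA, lift_genB, map_one] at hsp
  exact absurd (congrFun hsp 0) Nat.one_ne_zero

end BicyclicMonoid

/-- `x` and `y` generate a copy of the bicyclic monoid, with `x` as `a`, `y` as `b` and `x y` as
the identity element. -/
structure IsBicyclicPair {S : Type u} [Semigroup S] (x y : S) : Prop where
  mul_mul_left : x * y * x = x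
  left_mul_mul : x * (x * y) = x
  mul_mul_right : x * y * y = y
  right_mul_mul : y * (x * y) = y
  swap_ne : y * x ≠ x * y

/-- The corner `eSe` of an idempotent `e` is a monoid with identity element `e`. -/
instance cornerMonoid {S : Type u} [Semigroup S] {e : S} (he : IsIdempotentElem e) :
    Monoid he.Corner where
  __ : Semigroup he.Corner := inferInstanceAs (Semigroup (Subsemigroup.corner e))
  one := ⟨e, (Subsemigroup.mem_corner_iff he).2 ⟨he, he⟩⟩
  one_mul x := Subtype.ext ((Subsemigroup.mem_corner_iff he).1 x.2).1
  mul_one x := Subtype.ext ((Subsemigroup.mem_corner_iff he).1 x.2).2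

variable {S : Type u} [Semigroup S]

namespace IsBicyclicPair

variable {x y : S}

theorem isIdempotentElem (h : IsBicyclicPair x y) : IsIdempotentElem (x * y) := by
  rw [IsIdempotentElem, mul_assoc, h.right_mul_mul]

theorem containsBicyclic (h : IsBicyclicPair x y) : ContainsBicyclic S := by
  have he := h.isIdempotentElem
  let x' : he.Corner := ⟨x, (Subsemigroup.mem_corner_iff he).2 ⟨h.mul_mul_left, h.left_mul_mul⟩⟩
  let y' : he.Corner := ⟨y, (Subsemigroup.mem_corner_iff he).2 ⟨h.mul_mul_right, h.right_mul_mul⟩⟩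
  have hxy : x' * y' = 1 := rfl
  have hyx : y' * x' ≠ 1 := fun h1 => h.swap_ne (congrArg Subtype.val h1)
  let val : he.Corner →ₙ* S := MulMemClass.subtype (Subsemigroup.corner (x * y))
  exact ⟨val.comp (BicyclicMonoid.lift hxy : BicyclicMonoid →ₙ* he.Corner),
    Subtype.val_injective.comp (BicyclicMonoid.lift_injective hxy hyx)⟩

open MulOpposite in
theorem op_iff : IsBicyclicPair (op y) (op x) ↔ IsBicyclicPair x y :=
  ⟨fun ⟨hl, hl', hr, hr', hne⟩ => ⟨congrArg unop hr', congrArg unop hr, congrArg unop hl',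
      congrArg unop hl, fun h => hne (congrArg op h)⟩,
    fun ⟨hl, hl', hr, hr', hne⟩ => ⟨congrArg op hr', congrArg op hr, congrArg op hl',
      congrArg op hl, fun h => hne (congrArg unop h)⟩⟩

theorem not_isLeftStable (h : IsBicyclicPair x y) : ¬ IsLeftStable S := by
  intro hS
  have hidem : IsIdempotentElem (y * x) := by
    rw [IsIdempotentElem, mul_assoc, ← mul_assoc x, h.mul_mul_left]
  have hL : Green.L.le (y * x) (x * y) :=
    Green.L_le_iff.2 (.inr ⟨y * x, by rw [mul_assoc, h.left_mul_mul]⟩)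
  have hJ : Green.J.le (x * y) (y * x) := by
    have : x * y = x * (y * x) * y := by rw [mul_assoc, mul_assoc y, h.right_mul_mul]
    conv_lhs => rw [this]
    exact Green.J_mul_mul_le x (y * x) y
  have hL' := isLeftStable_iff.1 hS _ _ hL ⟨Green.J_le_of_le hL, hJ⟩
  have hxy : x * y * (y * x) = x * y := Green.mul_eq_of_L_le hidem hL'
  rw [← mul_assoc, h.mul_mul_right] at hxy
  exact h.swap_ne hxy

end IsBicyclicPair

theorem containsBicyclic_iff : ContainsBicyclic S ↔ ∃ x y : S, IsBicyclicPair x y := by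
  refine ⟨fun ⟨φ, hφ⟩ => ?_, fun ⟨x, y, h⟩ => h.containsBicyclic⟩
  have hab := BicyclicMonoid.genA_mul_genB
  refine ⟨φ BicyclicMonoid.genA, φ BicyclicMonoid.genB, ?_, ?_, ?_, ?_, ?_⟩
  · simp only [← map_mul, hab, one_mul]
  · simp only [← map_mul, hab, mul_one]
  · simp only [← map_mul, hab, one_mul]
  · simp only [← map_mul, hab, mul_one]
  · rw [← map_mul, ← map_mul, hab]
    exact hφ.ne BicyclicMonoid.genB_mul_genA_ne_one

theorem containsBicyclic_op_iff : ContainsBicyclic Sᵐᵒᵖ ↔ ContainsBicyclic S := by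
  simp only [containsBicyclic_iff, MulOpposite.exists, IsBicyclicPair.op_iff]
  exact exists_comm

theorem ContainsBicyclic.not_isLeftStable (h : ContainsBicyclic S) : ¬ IsLeftStable S := by
  obtain ⟨x, y, hxy⟩ := containsBicyclic_iff.1 h
  exact hxy.not_isLeftStable

theorem ContainsBicyclic.not_isRightStable (h : ContainsBicyclic S) : ¬ IsRightStable S :=
  mt isLeftStable_op_iff.2 (containsBicyclic_op_iff.2 h).not_isLeftStable

theorem isBicyclicPair_of_idempotent_lt {e f : S} (he : IsIdempotentElem e)
    (hf : IsIdempotentElem f) (hfe : f * e = e) (hef : e * f = e) (hJ : Green.J.le f e)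
    (hne : e ≠ f) : ∃ x y : S, IsBicyclicPair x y := by
  obtain ⟨s, t, hfs, htf, hst⟩ := Green.exists_mul_mul_eq_of_idempotent_J_le hf hJ
  have hxy : s * e * (e * t) = f := by rw [mul_assoc, ← mul_assoc e, he.eq, ← mul_assoc, hst]
  refine ⟨s * e, e * t, ?_, ?_, ?_, ?_, ?_⟩ <;> rw [hxy]
  · rw [← mul_assoc, hfs]
  · rw [mul_assoc, hef]
  · rw [← mul_assoc, hfe]
  · rw [mul_assoc, htf]
  · intro hyx
    apply hne
    rw [← hef, ← hyx, mul_assoc, ← mul_assoc e, he.eq]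

theorem IsRegularSemigroup.isLeftStable (h : IsRegularSemigroup S) (hB : ¬ ContainsBicyclic S) :
    IsLeftStable S := by
  refine isLeftStable_iff.2 fun a b hab hJ => ?_
  obtain ⟨e, he, hae⟩ := h.exists_idempotent_L_rel a
  obtain ⟨f, hf, hbf⟩ := h.exists_idempotent_L_rel b
  have hef : e * f = e :=
    Green.mul_eq_of_L_le hf (Green.L.le_trans hae.2 (Green.L.le_trans hab hbf.1))
  have hle : Green.L.le e (f * e) :=
    Green.L_le_iff.2 (.inr ⟨e, by rw [← mul_assoc, hef, he.eq]⟩)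
  have hfJ : Green.J.le f (f * e) :=
    Green.J.le_trans (Green.J_rel_of_rel hbf).2 (Green.J.le_trans hJ.2
      (Green.J_le_of_le (Green.L.le_trans hae.1 hle)))
  have hfe : f * e = f := by
    by_contra hne
    obtain ⟨x, y, hxy⟩ := isBicyclicPair_of_idempotent_lt (e := f * e)
      (by rw [IsIdempotentElem, mul_assoc, ← mul_assoc e, hef, he.eq]) hf
      (by rw [← mul_assoc, hf.eq]) (by rw [mul_assoc, hef]) hfJ hne
    exact hB hxy.containsBicyclic
  exact Green.L.le_trans hbf.1 (Green.L.le_trans (hfe ▸ Green.L_mul_le_right f e) hae.2)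

theorem IsRegularSemigroup.isRightStable (h : IsRegularSemigroup S) (hB : ¬ ContainsBicyclic S) :
    IsRightStable S :=
  isLeftStable_op_iff.1 (h.op.isLeftStable (mt containsBicyclic_op_iff.1 hB))

end Bicyclic

section ZeroElement

variable {S : Type u} [Semigroup S] {k : Green} {z : S}

theorem IsZeroElement.eq {w : S} (hz : IsZeroElement z) (hw : IsZeroElement w) : z = w :=
  (hz w).1.symm.trans (hw z).2

theorem IsZeroElement.le (hz : IsZeroElement z) (k : Green) (x : S) : k.le z x := by
  have hL : Green.L.le z x := Green.L_le_iff.2 (.inr ⟨z, (hz x).1.symm⟩)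
  have hR : Green.R.le z x := Green.R_le_iff.2 (.inr ⟨z, (hz x).2.symm⟩)
  cases k with
  | L => exact hL
  | R => exact hR
  | J => exact Green.J_le_of_le hL
  | H => exact Green.H_le_iff.2 ⟨hL, hR⟩

theorem IsZeroElement.le_iff (hz : IsZeroElement z) {x : S} : k.le x z ↔ x = z := by
  refine ⟨fun h => ?_, fun h => h ▸ k.le_refl x⟩
  obtain ⟨m, hm, hx⟩ := Green.J_le_iff_exists.1 (Green.J_le_of_le h)
  obtain rfl : m = z := (Green.L_le_iff.1 hm).elim id fun ⟨s, hs⟩ => hs.trans (hz s).2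
  exact (Green.R_le_iff.1 hx).elim id fun ⟨s, hs⟩ => hs.trans (hz s).1

theorem Green.exists_isMin_iff :
    (∃ d : k.Classes S, IsMin d) ↔ ∃ m : S, ∀ x, k.le x m → k.le m x := by
  have hsurj : Function.Surjective (k.classOf (S := S)) := k.exists_classOf_eq
  simp only [IsMin, hsurj.exists, hsurj.forall, k.classOf_le_classOf]

theorem IsZeroElement.exists_isZeroMinimal_iff (hz : IsZeroElement z) :
    (∃ d, IsZeroMinimal k z d) ↔ ∃ m, m ≠ z ∧ ∀ x, x ≠ z → k.le x m → k.le m x := by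
  have hsurj : Function.Surjective (k.classOf (S := S)) := k.exists_classOf_eq
  simp only [IsZeroMinimal, hsurj.exists, hsurj.forall, lt_iff_le_not_ge, k.classOf_le_classOf,
    k.classOf_eq_classOf, Green.rel, hz.le_iff, hz.le k, and_true]
  refine exists_congr fun m => ⟨fun h => ⟨?_, fun x hx hxm => ?_⟩, fun ⟨hm, h⟩ x => ⟨?_, ?_⟩⟩
  · rintro rfl
    exact ((h m).2 rfl).2 (k.le_refl m)
  · by_contra hmx
    exact hx ((h x).1 ⟨hxm, hmx⟩)
  · rintro ⟨hxm, hmx⟩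
    by_contra hx
    exact hmx (h x hx hxm)
  · rintro rfl
    exact ⟨hz.le k m, fun hmx => hm (hz.le_iff.1 hmx)⟩

end ZeroElement

section PrincipalFactor

variable {S : Type u} [Semigroup S] {c : Green.J.Classes S} {x y z : S}

theorem rel_of_mem_jClassSet (hx : x ∈ jClassSet c) (hy : y ∈ jClassSet c) : Green.J.rel x y :=
  (Green.classOf_eq_classOf _).1 (Eq.trans hx (Eq.symm hy))

theorem mem_jClassSet_of_le (hx : x ∈ jClassSet c) (hz : z ∈ jClassSet c) (hxy : Green.J.le x y)
    (hyz : Green.J.le y z) : y ∈ jClassSet c :=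
  Eq.trans ((Green.classOf_eq_classOf _).2
    ⟨Green.J.le_trans hyz (rel_of_mem_jClassSet hz hx).1, hxy⟩) hx

theorem jClassSet_nonempty (c : Green.J.Classes S) : (jClassSet c).Nonempty :=
  Green.J.exists_classOf_eq c

/-- A `J`-class is nonnull if the product of some two of its elements stays in it, that is, if its
principal factor is not a semigroup with zero multiplication. -/
def IsNonnull (c : Green.J.Classes S) : Prop :=
  ∃ x ∈ jClassSet c, ∃ y ∈ jClassSet c, x * y ∈ jClassSet c

/-- Some `m` in the `J`-class `c` has a minimal or 0-minimal `L`-class in the principal factor of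
`c`, expressed inside the ambient semigroup. -/
def HasMinimalLClass (c : Green.J.Classes S) : Prop :=
  ∃ m ∈ jClassSet c, ∀ s ∈ jClassSet c, s * m ∈ jClassSet c → Green.L.le m (s * m)

/-- Some `m` in the `J`-class `c` has a minimal or 0-minimal `R`-class in the principal factor of
`c`, expressed inside the ambient semigroup. -/
def HasMinimalRClass (c : Green.J.Classes S) : Prop :=
  ∃ m ∈ jClassSet c, ∀ s ∈ jClassSet c, m * s ∈ jClassSet c → Green.R.le m (m * s)

namespace IsNonnull

variable {a m : S}

theorem exists_eq_mul (hc : IsNonnull c) (ha : a ∈ jClassSet c) :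
    ∃ x ∈ jClassSet c, ∃ y ∈ jClassSet c, a = x * y := by
  obtain ⟨x, hx, y, hy, hxy⟩ := hc
  obtain ⟨x', y', hx', hy', rfl⟩ :=
    Green.exists_eq_mul_of_J_le_mul (rel_of_mem_jClassSet ha hxy).1
  exact ⟨x', mem_jClassSet_of_le ha hx (Green.J_mul_le_left _ _) (Green.J_le_of_le hx'),
    y', mem_jClassSet_of_le ha hy (Green.J_mul_le_right _ _) (Green.J_le_of_le hy'), rfl⟩

theorem exists_eq_mul_mul (hc : IsNonnull c) (ha : a ∈ jClassSet c) (hm : m ∈ jClassSet c) :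
    ∃ x ∈ jClassSet c, ∃ y ∈ jClassSet c, x * m ∈ jClassSet c ∧ a = x * m * y := by
  obtain ⟨x, hx, d, hd, rfl⟩ := hc.exists_eq_mul ha
  obtain ⟨b, hb, y, hy, rfl⟩ := hc.exists_eq_mul hd
  obtain ⟨x', y', hx', hy', he⟩ :=
    Green.exists_mul_mul_eq_of_J_le (rel_of_mem_jClassSet hb hm).1 x y
  rw [← mul_assoc, he] at ha ⊢
  have hxm : x' * m ∈ jClassSet c :=
    mem_jClassSet_of_le ha hm (Green.J_mul_le_left _ _) (Green.J_mul_le_right _ _)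
  exact ⟨x', mem_jClassSet_of_le hxm hx (Green.J_mul_le_left _ _) (Green.J_le_of_le hx'),
    y', mem_jClassSet_of_le ha hy (Green.J_mul_le_right _ _) (Green.J_le_of_le hy'), hxm, rfl⟩

end IsNonnull

/-- `ι` identifies `T` with the principal factor of the `J`-class `c`: the elements of `T` outside
the image of `c` are zeros, and a product falling outside `c` is sent outside the image. -/
structure IsPrincipalFactorMap {T : Type*} [Semigroup T] (ι : jClassSet c → T) : Prop where
  injective : Function.Injective ι
  mul_eq_iff (x y z : jClassSet c) : ι x * ι y = ι z ↔ (x : S) * y = z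
  isZeroElement {t : T} : t ∉ Set.range ι → IsZeroElement t

theorem ReesQuotient.mk_eq_of_iff {I : BiIdeal S} {a b : S} (hb : b ∉ I.carrier) :
    ReesQuotient.mk I a = ReesQuotient.of b hb ↔ a = b := by
  refine ⟨fun h => ?_, ?_⟩
  · by_cases ha : a ∈ I.carrier
    · rw [ReesQuotient.mk_of_mem ha] at h
      nomatch h
    · rw [ReesQuotient.mk_of_notMem ha] at h
      exact ReesQuotient.of.inj h
  · rintro rfl
    exact ReesQuotient.mk_of_notMem hb

theorem exists_isPrincipalFactorMap (c : Green.J.Classes S) :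
    ∃ ι : jClassSet c → principalFactor c, IsPrincipalFactorMap ι := by
  by_cases hc : IsMin c
  · rw [show principalFactor c = Semigrp.of (minimalIdeal c hc) from dif_pos hc]
    exact ⟨id, Function.injective_id, fun x y z => Subtype.ext_iff, fun ht => (ht ⟨_, rfl⟩).elim⟩
  · rw [show principalFactor c = Semigrp.of (ReesQuotient (belowIdeal c hc)) from dif_neg hc]
    let incl (x : jClassSet c) : principalIdeal c :=
      ⟨x, mem_principalIdealSet_iff.2 (le_of_eq x.2)⟩
    refine ⟨fun x => ReesQuotient.of (incl x) fun h => h x.2, fun x y h => ?_, fun x y z => ?_, ?_⟩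
    · have hxy : incl x = incl y := ReesQuotient.of.inj h
      exact Subtype.ext (congrArg (fun a : principalIdeal c => (a : S)) hxy)
    · exact (ReesQuotient.mk_eq_of_iff _).trans Subtype.ext_iff
    · rintro (_ | ⟨a, ha⟩) ht
      · exact fun t => ⟨ReesQuotient.zero_mul t, ReesQuotient.mul_zero t⟩
      · exact (ht ⟨⟨a, not_not.1 ha⟩, rfl⟩).elim

namespace IsPrincipalFactorMap

variable {T : Type*} [Semigroup T] {ι : jClassSet c → T}

theorem mem_range_iff (hι : IsPrincipalFactorMap ι) {z t : T} (hz : z ∉ Set.range ι) :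
    t ∈ Set.range ι ↔ t ≠ z :=
  ⟨fun ht h => hz (h ▸ ht), fun h => by_contra fun ht =>
    h ((hι.isZeroElement ht).eq (hι.isZeroElement hz))⟩

theorem isNonnull_of_mul_eq (hι : IsPrincipalFactorMap ι) {x y z : jClassSet c}
    (h : ι x * ι y = ι z) : IsNonnull c :=
  ⟨x, x.2, y, y.2, (hι.mul_eq_iff x y z).1 h ▸ z.2⟩

theorem J_le_of_isNonnull (hι : IsPrincipalFactorMap ι) (hc : IsNonnull c) (a b : jClassSet c) :
    Green.J.le (ι a) (ι b) := by
  obtain ⟨x, hx, y, hy, hxb, h⟩ := hc.exists_eq_mul_mul a.2 b.2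
  rw [← (hι.mul_eq_iff ⟨x * b, hxb⟩ ⟨y, hy⟩ a).2 h.symm,
    ← (hι.mul_eq_iff ⟨x, hx⟩ b ⟨x * b, hxb⟩).2 rfl]
  exact Green.J_mul_mul_le _ _ _

theorem L_le_iff (hι : IsPrincipalFactorMap ι) {x y : jClassSet c} :
    Green.L.le (ι x) (ι y) ↔ x = y ∨ ∃ s ∈ jClassSet c, (x : S) = s * y := by
  rw [Green.L_le_iff, hι.injective.eq_iff]
  refine or_congr_right ⟨fun ⟨t, ht⟩ => ?_, fun ⟨s, hs, h⟩ =>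
    ⟨ι ⟨s, hs⟩, ((hι.mul_eq_iff ⟨s, hs⟩ y x).2 h.symm).symm⟩⟩
  obtain ⟨s, rfl⟩ : t ∈ Set.range ι :=
    by_contra fun hr => hr ⟨x, ht.trans (hι.isZeroElement hr _).1⟩
  exact ⟨s, s.2, ((hι.mul_eq_iff s y x).1 ht.symm).symm⟩

theorem R_le_iff (hι : IsPrincipalFactorMap ι) {x y : jClassSet c} :
    Green.R.le (ι x) (ι y) ↔ x = y ∨ ∃ s ∈ jClassSet c, (x : S) = y * s := by
  rw [Green.R_le_iff, hι.injective.eq_iff]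
  refine or_congr_right ⟨fun ⟨t, ht⟩ => ?_, fun ⟨s, hs, h⟩ =>
    ⟨ι ⟨s, hs⟩, ((hι.mul_eq_iff y ⟨s, hs⟩ x).2 h.symm).symm⟩⟩
  obtain ⟨s, rfl⟩ : t ∈ Set.range ι :=
    by_contra fun hr => hr ⟨x, ht.trans (hι.isZeroElement hr _).2⟩
  exact ⟨s, s.2, ((hι.mul_eq_iff y s x).1 ht.symm).symm⟩

theorem isSimpleSemigroup_iff (hι : IsPrincipalFactorMap ι) :
    IsSimpleSemigroup T ↔ Function.Surjective ι ∧ IsNonnull c := by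
  obtain ⟨x, hx⟩ := jClassSet_nonempty c
  constructor
  · rintro ⟨-, hJ⟩
    have hsurj : Function.Surjective ι := fun t => by_contra fun ht =>
      ht ⟨⟨x, hx⟩, (hι.isZeroElement ht).le_iff.1 (hJ _ t).1⟩
    obtain ⟨z, hz⟩ := hsurj (ι ⟨x, hx⟩ * ι ⟨x, hx⟩)
    exact ⟨hsurj, hι.isNonnull_of_mul_eq hz.symm⟩
  · rintro ⟨hsurj, hc⟩
    refine ⟨⟨ι ⟨x, hx⟩⟩, hsurj.forall₂.2 fun a b => ?_⟩
    exact ⟨hι.J_le_of_isNonnull hc a b, hι.J_le_of_isNonnull hc b a⟩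

theorem isZeroSimpleWith_iff (hι : IsPrincipalFactorMap ι) {z : T} :
    IsZeroSimpleWith T z ↔ z ∉ Set.range ι ∧ IsNonnull c := by
  constructor
  · rintro ⟨hz, ⟨a, b, hab⟩, hJ⟩
    have hrange {t : T} (ht : t ≠ z) : t ∈ Set.range ι :=
      by_contra fun h => ht ((hι.isZeroElement h).eq hz)
    obtain ⟨x, rfl⟩ := hrange fun ha => hab (ha ▸ (hz b).1)
    obtain ⟨y, rfl⟩ : b ∈ Set.range ι := hrange (by rintro rfl; exact hab (hz _).2)
    obtain ⟨w, hw⟩ := hrange hab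
    have hc := hι.isNonnull_of_mul_eq hw.symm
    refine ⟨?_, hc⟩
    rintro ⟨v, rfl⟩
    exact hab (hw ▸ hz.le_iff.1 (hι.J_le_of_isNonnull hc w v))
  · rintro ⟨hz, hc⟩
    have hz0 := hι.isZeroElement hz
    refine ⟨hz0, ?_, fun a b => ⟨fun h => ⟨?_, ?_⟩, fun h => ?_⟩⟩
    · obtain ⟨x, hx, y, hy, hxy⟩ := hc
      refine ⟨ι ⟨x, hx⟩, ι ⟨y, hy⟩, ?_⟩
      rw [(hι.mul_eq_iff _ _ ⟨x * y, hxy⟩).2 rfl]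
      exact (hι.mem_range_iff hz).1 ⟨_, rfl⟩
    · rintro rfl
      exact hz0.le_iff.1 h.2
    · rintro rfl
      exact hz0.le_iff.1 h.1
    · by_cases ha : a = z
      · rw [ha, h.1 ha]
        exact ⟨Green.J.le_refl z, Green.J.le_refl z⟩
      · obtain ⟨x, rfl⟩ := (hι.mem_range_iff hz).2 ha
        obtain ⟨y, rfl⟩ := (hι.mem_range_iff hz).2 (mt h.2 ha)
        exact ⟨hι.J_le_of_isNonnull hc x y, hι.J_le_of_isNonnull hc y x⟩

theorem exists_isMin_iff (hsurj : Function.Surjective ι) {k : Green} :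
    (∃ d : k.Classes T, IsMin d) ↔ ∃ m, ∀ x, k.le (ι x) (ι m) → k.le (ι m) (ι x) := by
  rw [Green.exists_isMin_iff, hsurj.exists]
  simp only [hsurj.forall]

theorem exists_isZeroMinimal_iff (hι : IsPrincipalFactorMap ι) {k : Green} {z : T}
    (hz : z ∉ Set.range ι) :
    (∃ d, IsZeroMinimal k z d) ↔ ∃ m, ∀ x, k.le (ι x) (ι m) → k.le (ι m) (ι x) := by
  simp only [(hι.isZeroElement hz).exists_isZeroMinimal_iff, ← hι.mem_range_iff hz,
    Set.exists_range_iff, Set.forall_mem_range]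

theorem exists_L_minimal_iff (hι : IsPrincipalFactorMap ι) :
    (∃ m, ∀ x, Green.L.le (ι x) (ι m) → Green.L.le (ι m) (ι x)) ↔ HasMinimalLClass c := by
  refine ⟨fun ⟨m, hm⟩ => ⟨m, m.2, fun s hs hsm => ?_⟩, fun ⟨m, hmc, hm⟩ =>
    ⟨⟨m, hmc⟩, fun x hx => ?_⟩⟩
  · have hle := hm ⟨s * m, hsm⟩ (hι.L_le_iff.2 (.inr ⟨s, hs, rfl⟩))
    exact Green.L_le_iff.2 ((hι.L_le_iff.1 hle).imp (congrArg Subtype.val)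
      fun ⟨t, _, ht⟩ => ⟨t, ht⟩)
  · obtain rfl | ⟨s, hs, hxs⟩ := hι.L_le_iff.1 hx
    · exact Green.L.le_refl _
    obtain ht | ⟨t, ht⟩ := Green.L_le_iff.1 (hm s hs (hxs ▸ x.2))
    · exact hι.L_le_iff.2 (.inl (Subtype.ext (ht.trans hxs.symm)))
    have htst : m = t * s * t * x := by
      rw [hxs, mul_assoc _ t, ← ht, mul_assoc, ← ht]
    refine hι.L_le_iff.2 (.inr ⟨t * s * t, ?_, htst⟩)
    refine mem_jClassSet_of_le hmc hs ?_ (Green.J_mul_mul_le t s t)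
    conv_lhs => rw [htst]
    exact Green.J_mul_le_left _ _

theorem exists_R_minimal_iff (hι : IsPrincipalFactorMap ι) :
    (∃ m, ∀ x, Green.R.le (ι x) (ι m) → Green.R.le (ι m) (ι x)) ↔ HasMinimalRClass c := by
  refine ⟨fun ⟨m, hm⟩ => ⟨m, m.2, fun s hs hms => ?_⟩, fun ⟨m, hmc, hm⟩ =>
    ⟨⟨m, hmc⟩, fun x hx => ?_⟩⟩
  · have hle := hm ⟨m * s, hms⟩ (hι.R_le_iff.2 (.inr ⟨s, hs, rfl⟩))
    exact Green.R_le_iff.2 ((hι.R_le_iff.1 hle).imp (congrArg Subtype.val)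
      fun ⟨t, _, ht⟩ => ⟨t, ht⟩)
  · obtain rfl | ⟨s, hs, hxs⟩ := hι.R_le_iff.1 hx
    · exact Green.R.le_refl _
    obtain ht | ⟨t, ht⟩ := Green.R_le_iff.1 (hm s hs (hxs ▸ x.2))
    · exact hι.R_le_iff.2 (.inl (Subtype.ext (ht.trans hxs.symm)))
    have htst : m = x * (t * s * t) := by
      rw [hxs, ← mul_assoc, ← mul_assoc, ← ht, ← ht]
    refine hι.R_le_iff.2 (.inr ⟨t * s * t, ?_, htst⟩)
    refine mem_jClassSet_of_le hmc hs ?_ (Green.J_mul_mul_le t s t)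
    conv_lhs => rw [htst]
    exact Green.J_mul_le_right _ _

theorem isSimpleSemigroup_or_isZeroSimple_iff (hι : IsPrincipalFactorMap ι) :
    IsSimpleSemigroup T ∨ IsZeroSimple T ↔ IsNonnull c := by
  simp only [IsZeroSimple, hι.isSimpleSemigroup_iff, hι.isZeroSimpleWith_iff, exists_and_right,
    ← or_and_right, ← not_forall, Set.mem_range]
  exact and_iff_right (Classical.em _)

theorem isCompletelySimple_iff (hι : IsPrincipalFactorMap ι) :
    IsCompletelySimple T ↔
      Function.Surjective ι ∧ IsNonnull c ∧ HasMinimalLClass c ∧ HasMinimalRClass c := by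
  rw [IsCompletelySimple, hι.isSimpleSemigroup_iff, and_assoc]
  refine and_congr_right fun hsurj => ?_
  rw [exists_isMin_iff hsurj, exists_isMin_iff hsurj, hι.exists_L_minimal_iff,
    hι.exists_R_minimal_iff]

theorem isCompletelyZeroSimple_iff (hι : IsPrincipalFactorMap ι) :
    IsCompletelyZeroSimple T ↔
      ¬ Function.Surjective ι ∧ IsNonnull c ∧ HasMinimalLClass c ∧ HasMinimalRClass c := by
  rw [Function.Surjective, not_forall, ← exists_and_right]
  refine exists_congr fun z => ?_
  rw [hι.isZeroSimpleWith_iff, and_assoc]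
  refine and_congr_right fun hz => ?_
  rw [hι.exists_isZeroMinimal_iff hz, hι.exists_isZeroMinimal_iff hz, hι.exists_L_minimal_iff,
    hι.exists_R_minimal_iff]

end IsPrincipalFactorMap

theorem isSemisimpleSemigroup_iff :
    IsSemisimpleSemigroup S ↔ ∀ c : Green.J.Classes S, IsNonnull c := by
  refine forall_congr' fun c => ?_
  obtain ⟨ι, hι⟩ := exists_isPrincipalFactorMap c
  exact hι.isSimpleSemigroup_or_isZeroSimple_iff

theorem isCompletelySemisimple_iff :
    IsCompletelySemisimple S ↔
      ∀ c : Green.J.Classes S, IsNonnull c ∧ HasMinimalLClass c ∧ HasMinimalRClass c := by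
  refine forall_congr' fun c => ?_
  obtain ⟨ι, hι⟩ := exists_isPrincipalFactorMap c
  rw [hι.isCompletelySimple_iff, hι.isCompletelyZeroSimple_iff, ← or_and_right]
  exact and_iff_right (Classical.em _)

theorem isLeftStable_of_hasMinimalLClass (hn : ∀ c : Green.J.Classes S, IsNonnull c)
    (hm : ∀ c : Green.J.Classes S, HasMinimalLClass c) : IsLeftStable S := by
  refine isLeftStable_iff.2 fun a b hab hJ => ?_
  obtain ⟨c, hc⟩ : ∃ c, c = Green.J.classOf a := ⟨_, rfl⟩
  have ha : a ∈ jClassSet c := hc.symm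
  have hb : b ∈ jClassSet c := mem_jClassSet_of_le ha ha hJ.1 hJ.2
  obtain ⟨m, hmc, hmin⟩ := hm c
  obtain ⟨p, hp, q, -, -, rfl⟩ := (hn c).exists_eq_mul_mul hb hmc
  obtain rfl | ⟨s, rfl⟩ := Green.L_le_iff.1 hab
  · exact Green.L.le_refl _
  have hspmq : s * (p * m * q) = s * p * m * q := by simp only [mul_assoc]
  rw [hspmq] at ha ⊢
  have hspm : s * p * m ∈ jClassSet c :=
    mem_jClassSet_of_le ha hmc (Green.J_mul_le_left _ _) (Green.J_mul_le_right _ _)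
  have hsp : s * p ∈ jClassSet c :=
    mem_jClassSet_of_le hspm hp (Green.J_mul_le_left _ _) (Green.J_mul_le_right _ _)
  exact Green.L_le_mul_right (Green.L.le_trans (Green.L_mul_le_right p m) (hmin _ hsp hspm)) q

section Opposite

open MulOpposite

theorem op_mem_jClassSet_iff {a x : S} :
    op x ∈ jClassSet (Green.J.classOf (op a)) ↔ x ∈ jClassSet (Green.J.classOf a) :=
  (Green.classOf_eq_classOf _).trans (Green.J_rel_op_iff.trans (Green.classOf_eq_classOf _).symm)

theorem IsNonnull.classOf_op {a : S} (h : IsNonnull (Green.J.classOf a)) :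
    IsNonnull (Green.J.classOf (op a)) := by
  obtain ⟨x, hx, y, hy, hxy⟩ := h
  exact ⟨op y, op_mem_jClassSet_iff.2 hy, op x, op_mem_jClassSet_iff.2 hx,
    op_mem_jClassSet_iff.2 hxy⟩

theorem HasMinimalRClass.classOf_op {a : S} (h : HasMinimalRClass (Green.J.classOf a)) :
    HasMinimalLClass (Green.J.classOf (op a)) := by
  obtain ⟨m, hm, hmin⟩ := h
  refine ⟨op m, op_mem_jClassSet_iff.2 hm, MulOpposite.forall.2 fun s hs hsm => ?_⟩
  exact Green.L_le_op_iff.2 (hmin s (op_mem_jClassSet_iff.1 hs) (op_mem_jClassSet_iff.1 hsm))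

theorem isRightStable_of_hasMinimalRClass (hn : ∀ c : Green.J.Classes S, IsNonnull c)
    (hm : ∀ c : Green.J.Classes S, HasMinimalRClass c) : IsRightStable S := by
  have hsurj (c : Green.J.Classes Sᵐᵒᵖ) : ∃ a : S, Green.J.classOf (op a) = c :=
    MulOpposite.exists.1 (Green.J.exists_classOf_eq c)
  refine isLeftStable_op_iff.1 (isLeftStable_of_hasMinimalLClass (fun c => ?_) fun c => ?_)
  · obtain ⟨a, rfl⟩ := hsurj c
    exact (hn _).classOf_op
  · obtain ⟨a, rfl⟩ := hsurj c
    exact (hm _).classOf_op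

end Opposite

theorem IsRegularSemigroup.isCompletelySemisimple (h : IsRegularSemigroup S) (hs : IsStable S) :
    IsCompletelySemisimple S := by
  refine isCompletelySemisimple_iff.2 fun c => ?_
  obtain ⟨a, ha⟩ := jClassSet_nonempty c
  refine ⟨?_, ⟨a, ha, fun s _ hsa => ?_⟩, ⟨a, ha, fun s _ has => ?_⟩⟩
  · obtain ⟨b, hab, -⟩ := h a
    have haba : a * b * a ∈ jClassSet c := hab ▸ ha
    exact ⟨a * b, mem_jClassSet_of_le haba ha (Green.J_mul_le_left _ _) (Green.J_mul_le_left _ _),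
      a, ha, haba⟩
  · exact isLeftStable_iff.1 hs.1 _ _ (Green.L_mul_le_right s a) (rel_of_mem_jClassSet hsa ha)
  · exact isRightStable_iff.1 hs.2 _ _ (Green.R_mul_le_left a s) (rel_of_mem_jClassSet has ha)

theorem IsCompletelySemisimple.isSemisimpleSemigroup (h : IsCompletelySemisimple S) :
    IsSemisimpleSemigroup S :=
  fun c => (h c).imp And.left fun ⟨z, hz⟩ => ⟨z, hz.1⟩

theorem IsCompletelySemisimple.isStable (h : IsCompletelySemisimple S) : IsStable S := by
  have h := isCompletelySemisimple_iff.1 h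
  exact ⟨isLeftStable_of_hasMinimalLClass (fun c => (h c).1) fun c => (h c).2.1,
    isRightStable_of_hasMinimalRClass (fun c => (h c).1) fun c => (h c).2.2⟩

theorem IsSemisimpleSemigroup.isRegularSemigroup (h : IsSemisimpleSemigroup S)
    (hs : IsStable S) : IsRegularSemigroup S := by
  refine .of_forall_exists_eq_mul_mul fun a => ?_
  obtain ⟨b, hb, d, hd, hbd⟩ :=
    (isSemisimpleSemigroup_iff.1 h (Green.J.classOf a)).exists_eq_mul (a := a) rfl
  have hba : Green.R.le b a := isRightStable_iff.1 hs.2 a b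
    (hbd ▸ Green.R_mul_le_left b d) (rel_of_mem_jClassSet rfl hb)
  have hda : Green.L.le d a := isLeftStable_iff.1 hs.1 a d
    (hbd ▸ Green.L_mul_le_right b d) (rel_of_mem_jClassSet rfl hd)
  obtain rfl | ⟨u, rfl⟩ := Green.R_le_iff.1 hba <;> obtain rfl | ⟨v, rfl⟩ := Green.L_le_iff.1 hda
  · exact ⟨d, by rw [← hbd, ← hbd]⟩
  · exact ⟨v, by rw [mul_assoc, ← hbd]⟩
  · exact ⟨u, hbd⟩
  · exact ⟨u * v, by rw [← mul_assoc, mul_assoc, ← hbd]⟩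

end PrincipalFactor

theorem proposition6p5 (S : Type u) [Semigroup S] :
    List.TFAE
      [IsRegularSemigroup S ∧ IsStable S,
        IsRegularSemigroup S ∧ (IsLeftStable S ∨ IsRightStable S),
        IsCompletelySemisimple S,
        IsSemisimpleSemigroup S ∧ IsStable S,
        IsRegularSemigroup S ∧ ¬ ContainsBicyclic S] ∧
    (IsRegularSemigroup S ∧ IsStable S →
      Green.L.height S = Green.R.height S ∧
      Green.R.height S = Green.H.height S ∧
      Green.H.height S = idempotentHeight S ∧
      idempotentHeight S = Green.J.height S) := by
  refine ⟨?_, fun ⟨h, hs⟩ => h.heights_eq hs⟩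
  tfae_have 1 → 2 := fun ⟨h, hs⟩ => ⟨h, .inl hs.1⟩
  tfae_have 2 → 5 := fun ⟨h, hs⟩ =>
    ⟨h, fun hB => hs.elim hB.not_isLeftStable hB.not_isRightStable⟩
  tfae_have 5 → 1 := fun ⟨h, hB⟩ => ⟨h, h.isLeftStable hB, h.isRightStable hB⟩
  tfae_have 1 → 3 := fun ⟨h, hs⟩ => h.isCompletelySemisimple hs
  tfae_have 3 → 4 := fun h => ⟨h.isSemisimpleSemigroup, h.isStable⟩
  tfae_have 4 → 1 := fun ⟨h, hs⟩ => ⟨h.isRegularSemigroup hs, hs⟩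
  tfae_finish
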